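/- Let $G$ be a finite group and let $Z$ and $X$ be finite transitive $G$-sets. Let $C_2=\{0,1\}$ be the additive group of order two, and let $G$ act on $C_2^Z$ (the functions $Z\to C_2$) by $(g\omega)(z)=\omega(g^{-1}z)$. The wreath product $C_2\wr G$ is the set $C_2^Z\times G$ with the product $(\theta,g)(\omega,h)=(\theta+g\omega,gh)$; it acts on $C_2^Z\times X$ by $(\omega,g)(\theta,x)=(\omega+g\theta,gx)$. For a finite set $Y$ on which a group acts, $L(Y)$ denotes the permutation representation on the space of complex functions on $Y$, $(gf)(y)=f(g^{-1}y)$. For $\theta\in C_2^Z$ let $\chi_\theta(\omega)=(-1)^{\sum_{z\in Z}\theta(z)\omega(z)}$ be the corresponding character of $C_2^Z$, let $G_\theta=\{g\in G:\chi_\theta(g^{-1}\omega)=\chi_\theta(\omega)\text{ for all }\omega\in C_2^Z\}$ be its stabilizer, and let $\tilde\chi_\theta(\omega,g)=\chi_\theta(\omega)$ be its extension to $C_2\wr G_\theta\le C_2\wr G$. For an irreducible complex representation $\eta$ of $G_\theta$ let $\eta^\#(\omega,g)=\eta(g)$ be its inflation to $C_2\wr G_\theta$. Then for every $\theta\in C_2^Z$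 and every irreducible complex representation $\eta$ of $G_\theta$, the induced representation $\mathrm{Ind}_{C_2\wr G_\theta}^{C_2\wr G}(\tilde\chi_\theta\otimes\eta^\#)$ is irreducible, and its multiplicity in the $C_2\wr G$-representation $L(C_2^Z\times X)$ is equal to the multiplicity of $\eta$ in the restriction of $L(X)$ to $G_\theta$. Here the multiplicity of an irreducible representation $\sigma$ in a representation $\rho$ is the number of summands equivalent to $\sigma$ in a decomposition of $\rho$ as a direct sum of irreducible subrepresentations; such a decomposition exists in both cases, and the number does not depend on its choice. -/

import Mathlib

noncomputable section

namespace Lamplighter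

/-- The action of `G` on `C₂^Z = (Z → ZMod 2)`: `(g ω)(z) = ω (g⁻¹ z)`. -/
def shift {G Z : Type*} [Group G] [MulAction G Z] (g : G) (ω : Z → ZMod 2) : Z → ZMod 2 :=
  fun z => ω (g⁻¹ • z)

section ShiftLemmas

variable {G Z : Type*} [Group G] [MulAction G Z]

theorem shift_one (ω : Z → ZMod 2) : shift (1 : G) ω = ω := by
  funext z; simp [shift]

theorem shift_mul (g h : G) (ω : Z → ZMod 2) : shift (g * h) ω = shift g (shift h ω) := by
  funext z; simp [shift, mul_smul]

theorem shift_add (g : G) (ω ψ : Z → ZMod 2) : shift g (ω + ψ) = shift g ω + shift g ψ := rfl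

theorem shift_zero (g : G) : shift g (0 : Z → ZMod 2) = 0 := rfl

theorem add_self_eq_zero_fun (ω : Z → ZMod 2) : ω + ω = 0 := by
  funext z; exact CharTwo.add_self_eq_zero _

end ShiftLemmas

/-- The wreath product `C₂ ≀ G` with respect to the action of `G` on `Z`: pairs `(ω, g)` with
`ω ∈ C₂^Z` and `g ∈ G`. -/
@[ext]
structure WreathC2 (Z G : Type*) where
  lamps : Z → ZMod 2
  pos : G

namespace WreathC2

variable {G Z : Type*} [Group G] [MulAction G Z]

/-- The group law `(θ, g) (ω, h) = (θ + g ω, g h)`. -/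
instance : Group (WreathC2 Z G) where
  mul a b := ⟨a.lamps + shift a.pos b.lamps, a.pos * b.pos⟩
  one := ⟨0, 1⟩
  inv a := ⟨shift a.pos⁻¹ a.lamps, a.pos⁻¹⟩
  mul_assoc a b c := by
    refine WreathC2.ext ?_ (mul_assoc _ _ _)
    change (a.lamps + shift a.pos b.lamps) + shift (a.pos * b.pos) c.lamps
      = a.lamps + shift a.pos (b.lamps + shift b.pos c.lamps)
    rw [shift_mul, shift_add, add_assoc]
  one_mul a := by
    refine WreathC2.ext ?_ (one_mul _)
    change 0 + shift (1 : G) a.lamps = a.lamps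
    rw [shift_one, zero_add]
  mul_one a := by
    refine WreathC2.ext ?_ (mul_one _)
    change a.lamps + shift a.pos 0 = a.lamps
    rw [shift_zero, add_zero]
  inv_mul_cancel a := by
    refine WreathC2.ext ?_ (inv_mul_cancel _)
    change shift a.pos⁻¹ a.lamps + shift a.pos⁻¹ a.lamps = 0
    exact add_self_eq_zero_fun _

@[simp] theorem mul_lamps (a b : WreathC2 Z G) :
    (a * b).lamps = a.lamps + shift a.pos b.lamps := rfl
@[simp] theorem mul_pos (a b : WreathC2 Z G) : (a * b).pos = a.pos * b.pos := rfl
@[simp] theorem one_lamps : (1 : WreathC2 Z G).lamps = 0 := rfl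
@[simp] theorem one_pos : (1 : WreathC2 Z G).pos = 1 := rfl
@[simp] theorem inv_lamps (a : WreathC2 Z G) : (a⁻¹).lamps = shift a.pos⁻¹ a.lamps := rfl
@[simp] theorem inv_pos (a : WreathC2 Z G) : (a⁻¹).pos = a.pos⁻¹ := rfl

/-- The projection `C₂ ≀ G → G`, `(ω, g) ↦ g`. -/
def proj (Z G : Type*) [Group G] [MulAction G Z] : WreathC2 Z G →* G where
  toFun a := a.pos
  map_one' := rfl
  map_mul' _ _ := rfl

/-- For a subgroup `K` of `G`, the inclusion `C₂ ≀ K → C₂ ≀ G`, `(ω, k) ↦ (ω, k)`. -/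
def incl (Z : Type*) [MulAction G Z] (K : Subgroup G) : WreathC2 Z K →* WreathC2 Z G where
  toFun a := ⟨a.lamps, (a.pos : G)⟩
  map_one' := rfl
  map_mul' _ _ := rfl

/-- `C₂ ≀ G` acts on `C₂^Z × X` by `(ω, g) (θ, x) = (ω + g θ, g x)`. -/
instance {X : Type*} [MulAction G X] : MulAction (WreathC2 Z G) ((Z → ZMod 2) × X) where
  smul a p := (a.lamps + shift a.pos p.1, a.pos • p.2)
  one_smul p := by
    refine Prod.ext ?_ (one_smul G p.2)
    change 0 + shift (1 : G) p.1 = p.1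
    rw [shift_one, zero_add]
  mul_smul a b p := by
    refine Prod.ext ?_ (mul_smul a.pos b.pos p.2)
    change (a.lamps + shift a.pos b.lamps) + shift (a.pos * b.pos) p.1
      = a.lamps + shift a.pos (b.lamps + shift b.pos p.1)
    rw [shift_mul, shift_add, add_assoc]

theorem smul_def {X : Type*} [MulAction G X] (a : WreathC2 Z G) (p : (Z → ZMod 2) × X) :
    a • p = (a.lamps + shift a.pos p.1, a.pos • p.2) := rfl

end WreathC2

/-- The character `χ_θ(ω) = (-1) ^ (∑ z, θ(z) ω(z))` of `C₂^Z`. -/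
def chi {Z : Type*} [Fintype Z] (θ ω : Z → ZMod 2) : ℂ :=
  (-1) ^ (∑ z, (θ z).val * (ω z).val)

theorem chi_zero {Z : Type*} [Fintype Z] (θ : Z → ZMod 2) : chi θ 0 = 1 := by
  simp [chi]

theorem chi_add {Z : Type*} [Fintype Z] (θ ω ψ : Z → ZMod 2) :
    chi θ (ω + ψ) = chi θ ω * chi θ ψ := by
  have key : ∀ a b c : ZMod 2,
      (-1 : ℂ) ^ (a.val * (b + c).val) = (-1) ^ (a.val * b.val) * (-1) ^ (a.val * c.val) := by
    intro a b c
    rw [← pow_add]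
    apply neg_one_pow_congr
    revert a b c
    decide
  simp only [chi, ← Finset.prod_pow_eq_pow_sum, ← Finset.prod_mul_distrib]
  exact Finset.prod_congr rfl fun z _ => key _ _ _

/-- `G_θ = {g ∈ G : g χ_θ = χ_θ}`, where `(g χ)(ω) = χ (g⁻¹ ω)`. -/
def charStabilizer (G : Type*) {Z : Type*} [Group G] [MulAction G Z] [Fintype Z]
    (θ : Z → ZMod 2) : Subgroup G where
  carrier := {g | ∀ ω, chi θ (shift g⁻¹ ω) = chi θ ω}
  one_mem' ω := by rw [inv_one, shift_one]
  mul_mem' {a b} ha hb ω := by rw [mul_inv_rev, shift_mul, hb, ha]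
  inv_mem' {a} ha ω := by
    rw [← ha (shift a⁻¹⁻¹ ω), ← shift_mul, inv_inv, inv_mul_cancel, shift_one]

/-- The extension `χ̃_θ` of `χ_θ` to a one-dimensional representation of `C₂ ≀ G_θ`:
`χ̃_θ(ω, g) = χ_θ(ω)`. -/
def charExtension (G : Type*) {Z : Type*} [Group G] [MulAction G Z] [Fintype Z]
    (θ : Z → ZMod 2) : Representation ℂ (WreathC2 Z (charStabilizer G θ)) ℂ where
  toFun a := chi θ a.lamps • LinearMap.id
  map_one' := by
    rw [WreathC2.one_lamps, chi_zero, one_smul]; rfl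
  map_mul' a b := by
    have h : chi θ (shift a.pos b.lamps) = chi θ b.lamps := by
      have := (charStabilizer G θ).inv_mem a.pos.2 b.lamps
      rw [inv_inv] at this
      exact this
    ext
    simp [chi_add, h, mul_comm]

/-- The inflation `η^#(ω, g) = η(g)` of a representation `η` of `G` to `C₂ ≀ G`. -/
def inflation (Z : Type*) {G V : Type*} [Group G] [MulAction G Z] [AddCommGroup V] [Module ℂ V]
    (η : Representation ℂ G V) : Representation ℂ (WreathC2 Z G) V :=
  η.comp (WreathC2.proj Z G)

/-- The representation `Ind_{C₂ ≀ G_θ}^{C₂ ≀ G} (χ̃_θ ⊗ η^#)` of `C₂ ≀ G`. -/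
abbrev inducedRep {G Z V : Type*} [Group G] [MulAction G Z] [Fintype Z]
    [AddCommGroup V] [Module ℂ V] (θ : Z → ZMod 2)
    (η : Representation ℂ (charStabilizer G θ) V) :=
  Representation.ind (WreathC2.incl Z (charStabilizer G θ))
    (Representation.tprod (charExtension G θ) (inflation Z η))

/-- The permutation representation of `G` on the space `L(Y)` of all complex functions on `Y`:
`(g f)(y) = f (g⁻¹ y)`. -/
def permRep (G Y : Type*) [Group G] [MulAction G Y] : Representation ℂ G (Y → ℂ) where
  toFun g := LinearMap.funLeft ℂ ℂ (fun y => g⁻¹ • y)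
  map_one' := by ext f y; simp [LinearMap.funLeft]
  map_mul' g h := by
    refine LinearMap.ext fun f => funext fun y => ?_
    simp [LinearMap.funLeft_apply, mul_smul]

/-- `W 0, …, W (n-1)` are irreducible invariant subspaces of `ρ` and the space of `ρ` is their
(internal) direct sum. -/
def IsIrreducibleDecomposition {G V : Type*} [Group G] [AddCommGroup V] [Module ℂ V]
    (ρ : Representation ℂ G V) {n : ℕ} (W : Fin n → Subrepresentation ρ) : Prop :=
  DirectSum.IsInternal (fun i => (W i).toSubmodule) ∧
    ∀ i, ((W i).toRepresentation).IsIrreducible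

/-- `σ` is an irreducible representation whose multiplicity in the representation `ρ` is `m`:
`ρ` is a direct sum of finitely many irreducible subrepresentations, and in every such
decomposition exactly `m` of the summands are equivalent to `σ`. -/
def HasMultiplicity {G U V : Type*} [Group G] [AddCommGroup U] [Module ℂ U]
    [AddCommGroup V] [Module ℂ V]
    (σ : Representation ℂ G U) (ρ : Representation ℂ G V) (m : ℕ) : Prop :=
  σ.IsIrreducible ∧
  (∃ (n : ℕ) (W : Fin n → Subrepresentation ρ),
    IsIrreducibleDecomposition ρ W) ∧
  ∀ (n : ℕ) (W : Fin n → Subrepresentation ρ), IsIrreducibleDecomposition ρ W →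
    Nat.card {i : Fin n // Nonempty (σ.Equiv (W i).toRepresentation)} = m

end Lamplighter

end

/-! Over ℂ, Schur's lemma and complete reducibility turn the multiplicity of an irreducible `σ` in
`ρ` into the dimension of `Hom(σ, ρ)` (`hasMultiplicity_finrank`). The two multiplicities agree
because the Hom spaces are isomorphic: Frobenius reciprocity (`indIntertwiningMapEquiv`) restricts
to `C₂ ≀ G_θ`, and there a `χ_θ`-equivariant function on `C₂^Z × X` is determined by its values on
the slice `{0} × X` (`twistedInflationEquiv`).

Irreducibility is the little-group argument. The normal subgroup `C₂^Z` acts on the translate of the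
inducing space by `s` through the conjugate character `s χ_θ`, so character orthogonality makes
`chiProjection` kill every translate outside `G_θ`. A nonzero invariant subspace therefore meets the
inducing space, a copy of `η`; it contains that copy, hence all its translates. -/

namespace Representation

open scoped MonoidAlgebra

/-! ### Multiplicities as dimensions of spaces of intertwining maps -/

section Irreducible

variable {k G V : Type*} [Field k] [Group G] [AddCommGroup V] [Module k V]

/-- An irreducible representation of a finite group is finite-dimensional. -/
theorem IsIrreducible.finiteDimensional [Finite G] {ρ : Representation k G V}
    (hρ : ρ.IsIrreducible) : FiniteDimensional k V := by
  rcases subsingleton_or_nontrivial V with _ | _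
  · infer_instance
  obtain ⟨v, hv⟩ := exists_ne (0 : V)
  -- The span of the orbit of `v` is invariant, and it has finitely many generators since `G` is
  -- finite.
  let S : Subrepresentation ρ :=
    { toSubmodule := Submodule.span k (Set.range fun g => ρ g v)
      apply_mem_toSubmodule := by
        intro g w hw
        refine Submodule.span_induction (p := fun w _ => ρ g w ∈
          Submodule.span k (Set.range fun g => ρ g v)) ?_ ?_ ?_ ?_ hw
        · rintro _ ⟨h, rfl⟩
          exact Submodule.subset_span ⟨g * h, by simp⟩
        · simp
        · intro x y _ _ hx hy
          rw [map_add]; exact add_mem hx hy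
        · intro c x _ hx
          rw [map_smul]; exact Submodule.smul_mem _ c hx }
  have hvS : v ∈ S.toSubmodule := Submodule.subset_span ⟨1, by simp⟩
  rcases eq_bot_or_eq_top S with h | h
  · rw [h] at hvS
    exact absurd hvS hv
  · have : (Submodule.span k (Set.range fun g => ρ g v)) = ⊤ :=
      congrArg Subrepresentation.toSubmodule h
    exact ⟨Submodule.fg_def.mpr ⟨_, Set.finite_range _, this⟩⟩

/-- The `k[G]`-module underlying a subrepresentation is the corresponding `k[G]`-submodule. -/
def asModuleSubrepresentationEquiv {ρ : Representation k G V} (W : Subrepresentation ρ) :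
    W.toRepresentation.asModule ≃ₗ[k[G]] W.asSubmodule where
  toFun w := (⟨(w : W.toSubmodule).1, (w : W.toSubmodule).2⟩ : W.asSubmodule)
  invFun w := (⟨w.1, w.2⟩ : W.toSubmodule)
  left_inv _ := rfl
  right_inv _ := rfl
  map_add' _ _ := rfl
  map_smul' c w := by
    induction c using MonoidAlgebra.induction_linear with
    | zero => simp only [zero_smul, RingHom.id_apply]; rfl
    | add x y hx hy =>
      simp only [add_smul, RingHom.id_apply] at hx hy ⊢
      rw [← hx, ← hy]; rfl
    | single g a =>
      apply Subtype.ext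
      simp only [RingHom.id_apply]
      rw [Representation.single_smul]
      exact (Representation.single_smul (ρ := ρ) a g _).symm

end Irreducible

section Multiplicity

variable {k G U V : Type*} [Field k] [Group G] [AddCommGroup U] [Module k U]
  [AddCommGroup V] [Module k V]

/-- Intertwining maps into an internal direct sum are families of intertwining maps into the
summands. -/
theorem exists_linearEquiv_pi_intertwiningMap {ι : Type*} [Fintype ι] [DecidableEq ι]
    (σ : Representation k G U) {ρ : Representation k G V} (W : ι → Subrepresentation ρ)
    (hW : DirectSum.IsInternal fun i => (W i).toSubmodule) :
    Nonempty (IntertwiningMap σ ρ ≃ₗ[k] Π i, IntertwiningMap σ (W i).toRepresentation) := by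
  have hW' : DirectSum.IsInternal fun i => (W i).asSubmodule := hW
  let e : ρ.asModule ≃ₗ[k[G]] Π i, (W i).toRepresentation.asModule :=
    (LinearEquiv.ofBijective (DirectSum.coeLinearMap fun i => (W i).asSubmodule) hW').symm ≪≫ₗ
      DirectSum.linearEquivFunOnFintype k[G] ι (fun i => (W i).asSubmodule) ≪≫ₗ
      LinearEquiv.piCongrRight fun i => (asModuleSubrepresentationEquiv (W i)).symm
  let E : (σ.asModule →ₗ[k[G]] ρ.asModule) ≃ₗ[k]
      Π i, (σ.asModule →ₗ[k[G]] (W i).toRepresentation.asModule) :=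
    { toFun := fun f i => LinearMap.proj i ∘ₗ e.toLinearMap ∘ₗ f
      invFun := fun f => e.symm.toLinearMap ∘ₗ LinearMap.pi f
      left_inv := fun f => by
        ext x
        simp only [LinearMap.comp_apply, LinearEquiv.coe_coe]
        rw [LinearEquiv.symm_apply_eq]
        rfl
      right_inv := fun f => by
        ext i x
        simp
      map_add' := fun f g => by
        ext i x
        simp
      map_smul' := fun c f => by
        ext i x
        have := congrFun (LinearMap.map_smul_of_tower e.toLinearMap c (f x)) i
        exact this }
  exact ⟨IntertwiningMap.equivLinearMapAsModule σ ρ ≪≫ₗ E ≪≫ₗ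
    (LinearEquiv.piCongrRight fun i =>
      (IntertwiningMap.equivLinearMapAsModule σ (W i).toRepresentation).symm)⟩

/-- **Schur's lemma**, dimension form. -/
theorem IsIrreducible.finrank_intertwiningMap [IsAlgClosed k] [FiniteDimensional k U]
    {σ : Representation k G U} {ρ : Representation k G V}
    (hσ : σ.IsIrreducible) (hρ : ρ.IsIrreducible) [Decidable (Nonempty (σ.Equiv ρ))] :
    Module.finrank k (IntertwiningMap σ ρ) = if Nonempty (σ.Equiv ρ) then 1 else 0 := by
  split_ifs with h
  · obtain ⟨e⟩ := h
    rw [← finrank_intertwiningMap_self σ]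
    refine LinearEquiv.finrank_eq
      { toFun := fun f => e.symm.toIntertwiningMap.comp f
        invFun := fun f => e.toIntertwiningMap.comp f
        left_inv := fun f => by ext; simp
        right_inv := fun f => by ext; simp
        map_add' := fun f g => by ext; simp
        map_smul' := fun c f => by ext; simp }
  · have : IsEmpty (σ.Equiv ρ) := not_nonempty_iff.mp h
    exact Module.finrank_zero_of_subsingleton

end Multiplicity

end Representation

namespace Lamplighter

open Representation
open scoped MonoidAlgebra

variable {G U V : Type*} [Group G] [AddCommGroup U] [Module ℂ U] [AddCommGroup V] [Module ℂ V]

/-- A finite-dimensional complex representation of a finite group is a direct sum of irreducible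
subrepresentations. -/
theorem exists_isIrreducibleDecomposition [Finite G] [FiniteDimensional ℂ V]
    (ρ : Representation ℂ G V) :
    ∃ (n : ℕ) (W : Fin n → Subrepresentation ρ), IsIrreducibleDecomposition ρ W := by
  -- Invertibility of `|G|` is the hypothesis of Maschke's theorem, which makes `ρ.asModule`
  -- semisimple.
  have : NeZero (Nat.card G : ℂ) := ⟨by exact_mod_cast Nat.card_pos.ne'⟩
  have : Module.Finite ℂ[G] ρ.asModule := Module.Finite.of_restrictScalars_finite ℂ _ _
  obtain ⟨s, hs, htop, hsimple⟩ :=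
    IsSemisimpleModule.exists_sSupIndep_sSup_simples_eq_top ℂ[G] ρ.asModule
  have hind := (sSupIndep_iff _).mp hs
  have : ∀ m : s, IsSimpleModule ℂ[G] m.1 := fun m => hsimple m.1 m.2
  have hfin : Finite s := WellFoundedGT.finite_of_iSupIndep hind fun m =>
    (Submodule.nontrivial_iff_ne_bot.mp (IsSimpleModule.nontrivial ℂ[G] m.1))
  obtain ⟨n, ⟨e⟩⟩ := Finite.exists_equiv_fin s
  refine ⟨n, fun i => Subrepresentation.ofSubmodule' (e.symm i).1, ?_, fun i => ?_⟩
  · have : DirectSum.IsInternal fun i => (e.symm i).1 :=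
      DirectSum.isInternal_submodule_of_iSupIndep_of_iSup_eq_top
        (hind.comp e.symm.injective) (by
          rw [← htop, sSup_eq_iSup']
          exact e.symm.iSup_comp (g := fun m : s => m.1))
    exact this
  · rw [irreducible_iff_isSimpleModule_asModule]
    have : IsSimpleModule ℂ[G] (Subrepresentation.ofSubmodule' (e.symm i).1).asSubmodule :=
      hsimple _ (e.symm i).2
    exact IsSimpleModule.congr (asModuleSubrepresentationEquiv _)

/-- The multiplicity of an irreducible representation is the dimension of the space of intertwining
maps. -/
theorem hasMultiplicity_finrank [Finite G] [FiniteDimensional ℂ V]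
    {σ : Representation ℂ G U} (hσ : σ.IsIrreducible) (ρ : Representation ℂ G V) :
    HasMultiplicity σ ρ (Module.finrank ℂ (IntertwiningMap σ ρ)) := by
  classical
  have := hσ.finiteDimensional
  refine ⟨hσ, exists_isIrreducibleDecomposition ρ, fun n W hW => ?_⟩
  obtain ⟨e⟩ := exists_linearEquiv_pi_intertwiningMap σ W hW.1
  rw [e.finrank_eq, Module.finrank_pi_fintype,
    Finset.sum_congr rfl fun i _ => hσ.finrank_intertwiningMap (hW.2 i), Finset.sum_boole,
    Nat.card_eq_fintype_card, Fintype.card_subtype]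
  simp

end Lamplighter

noncomputable section

open scoped TensorProduct

namespace Representation

open scoped MonoidAlgebra

/-! ### Induced representations and Frobenius reciprocity -/

section Induction

variable {k G H A B : Type*} [Field k] [Group G] [Group H] (φ : G →* H)
  [AddCommGroup A] [Module k A] (ρ : Representation k G A)
  [AddCommGroup B] [Module k B] (τ : Representation k H B)

/-- This is the relation that defines the coinvariants of `k[H] ⊗ A`. -/
theorem IndV.mk_apply (g : G) (h : H) (a : A) :
    IndV.mk φ ρ (φ g * h) (ρ g a) = IndV.mk φ ρ h a := by
  have := Coinvariants.mk_self_apply (Representation.tprod ((leftRegular k H).comp φ) ρ) g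
    (MonoidAlgebra.single h 1 ⊗ₜ a)
  simpa using this

theorem ind_apply_mk_one (h : H) (a : A) :
    ind φ ρ h (IndV.mk φ ρ 1 a) = IndV.mk φ ρ h⁻¹ a := by
  rw [ind_mk, one_mul]

/-- On the image of the inducing group, the induced representation extends the given one. -/
theorem ind_map_apply_mk_one (g : G) (a : A) :
    ind φ ρ (φ g) (IndV.mk φ ρ 1 a) = IndV.mk φ ρ 1 (ρ g a) := by
  rw [ind_apply_mk_one, ← IndV.mk_apply φ ρ g, mul_inv_cancel]

theorem ind_hom_ext {f g : IndV φ ρ →ₗ[k] B}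
    (h : ∀ s a, f (ind φ ρ s (IndV.mk φ ρ 1 a)) = g (ind φ ρ s (IndV.mk φ ρ 1 a))) : f = g := by
  refine IndV.hom_ext φ ρ fun s => LinearMap.ext fun a => ?_
  have := h s⁻¹ a
  rwa [ind_apply_mk_one, inv_inv] at this

/-- A linear map out of an induced representation, from a compatible family of linear maps. -/
def IndV.lift (F : H → A →ₗ[k] B) (hF : ∀ g h a, F (φ g * h) (ρ g a) = F h a) :
    IndV φ ρ →ₗ[k] B :=
  Coinvariants.lift _
    (TensorProduct.lift <| (Finsupp.lift _ _ _ F) ∘ₗ (MonoidAlgebra.coeffLinearEquiv k).toLinearMap)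
    fun g => by
      ext h x
      simpa [MonoidAlgebra.lsingle_apply, ofMulAction_single] using hF g h x

@[simp]
theorem IndV.lift_mk (F : H → A →ₗ[k] B) (hF : ∀ g h a, F (φ g * h) (ρ g a) = F h a)
    (h : H) (a : A) : IndV.lift φ ρ F hF (IndV.mk φ ρ h a) = F h a := by
  simp [IndV.lift]

theorem IndV.mk_one_injective (hφ : Function.Injective φ) :
    Function.Injective (IndV.mk φ ρ 1) := by
  classical
  -- `F` is `φ g ↦ ρ g⁻¹` extended by zero off the image of `φ`; its lift is a left inverse of
  -- `IndV.mk φ ρ 1`.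
  let F : H → A →ₗ[k] A := fun h => if hh : ∃ g, φ g = h then ρ hh.choose⁻¹ else 0
  have hFφ : ∀ g, F (φ g) = ρ g⁻¹ := fun g => by
    have hh : ∃ g', φ g' = φ g := ⟨g, rfl⟩
    simp only [F, dif_pos hh]
    rw [hφ hh.choose_spec]
  have hF : ∀ g h a, F (φ g * h) (ρ g a) = F h a := fun g h a => by
    by_cases hh : ∃ g', φ g' = h
    · obtain ⟨g', rfl⟩ := hh
      rw [← map_mul, hFφ, hFφ, mul_inv_rev, map_mul, Module.End.mul_apply, inv_self_apply]
    · have hh' : ¬ ∃ g', φ g' = φ g * h := fun ⟨g', hg'⟩ =>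
        hh ⟨g⁻¹ * g', by rw [map_mul, hg', map_inv, inv_mul_cancel_left]⟩
      simp only [F, dif_neg hh, dif_neg hh', LinearMap.zero_apply]
  intro a b hab
  have := congrArg (IndV.lift φ ρ F hF) hab
  rw [IndV.lift_mk, IndV.lift_mk, ← map_one φ, hFφ] at this
  simpa using this

/-- The linear map out of an induced representation that extends an intertwining map. -/
def indLift (f : IntertwiningMap ρ (τ.comp φ)) : IndV φ ρ →ₗ[k] B :=
  IndV.lift φ ρ (fun h => τ h⁻¹ ∘ₗ f.toLinearMap) fun g h a => by
    have : f (ρ g a) = τ (φ g) (f a) := f.isIntertwining _ _ g a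
    simp only [LinearMap.comp_apply, IntertwiningMap.coe_toLinearMap]
    rw [this, mul_inv_rev, map_mul, Module.End.mul_apply, inv_self_apply]

theorem indLift_mk (f : IntertwiningMap ρ (τ.comp φ)) (h : H) (a : A) :
    indLift φ ρ τ f (IndV.mk φ ρ h a) = τ h⁻¹ (f a) :=
  IndV.lift_mk φ ρ _ _ h a

/-- **Frobenius reciprocity**. -/
def indIntertwiningMapEquiv :
    IntertwiningMap (ind φ ρ) τ ≃ₗ[k] IntertwiningMap ρ (τ.comp φ) where
  toFun f := ⟨f.toLinearMap ∘ₗ IndV.mk φ ρ 1, fun g => by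
    ext a
    have := f.isIntertwining _ _ (φ g) (IndV.mk φ ρ 1 a)
    rwa [ind_map_apply_mk_one] at this⟩
  invFun f := ⟨indLift φ ρ τ f, fun h => by
    refine IndV.hom_ext φ ρ fun s => LinearMap.ext fun a => ?_
    have h₁ : indLift φ ρ τ f (ind φ ρ h (IndV.mk φ ρ s a)) =
        τ h (indLift φ ρ τ f (IndV.mk φ ρ s a)) := by
      rw [ind_mk, indLift_mk, indLift_mk, mul_inv_rev, inv_inv, map_mul, Module.End.mul_apply]
    exact h₁⟩
  left_inv f := by
    refine IntertwiningMap.ext (IndV.hom_ext φ ρ fun s => LinearMap.ext fun a => ?_)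
    refine (indLift_mk φ ρ τ _ s a).trans ?_
    have : f (ind φ ρ s⁻¹ (IndV.mk φ ρ 1 a)) = τ s⁻¹ (f (IndV.mk φ ρ 1 a)) :=
      f.isIntertwining _ _ _ _
    rw [ind_apply_mk_one, inv_inv] at this
    exact this.symm
  right_inv f := by
    refine IntertwiningMap.ext (LinearMap.ext fun a => ?_)
    refine (indLift_mk φ ρ τ f 1 a).trans ?_
    simp
  map_add' _ _ := rfl
  map_smul' _ _ := rfl

end Induction

end Representation

end

noncomputable section

open scoped TensorProduct

/-! ### Characters of `C₂^Z` and intertwining maps into `L(C₂^Z × X)` -/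

namespace Lamplighter

open Representation

variable {G Z X V : Type*} [Group G] [MulAction G Z] [MulAction G X]
  [AddCommGroup V] [Module ℂ V]

instance WreathC2.instFinite [Finite Z] [Finite G] : Finite (WreathC2 Z G) :=
  Finite.of_injective (fun a : WreathC2 Z G => (a.lamps, a.pos)) fun _ _ h =>
    WreathC2.ext (congrArg Prod.fst h) (congrArg Prod.snd h)

theorem WreathC2.incl_injective (K : Subgroup G) : Function.Injective (WreathC2.incl Z K) :=
  fun _ _ h => WreathC2.ext (congrArg (fun c : WreathC2 Z G => c.lamps) h)
    (Subtype.ext (congrArg (fun c : WreathC2 Z G => c.pos) h))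

theorem permRep_apply {Y : Type*} [MulAction G Y] (g : G) (f : Y → ℂ) (y : Y) :
    permRep G Y g f y = f (g⁻¹ • y) := rfl

variable [Fintype Z] (θ : Z → ZMod 2)

theorem chi_mul_self (ω : Z → ZMod 2) : chi θ ω * chi θ ω = 1 := by
  rw [← chi_add, add_self_eq_zero_fun, chi_zero]

/-- Orthogonality of the characters `χ_θ` and `g χ_θ`. -/
theorem sum_chi_mul_chi_shift [DecidableEq Z] (g : G) [Decidable (g ∈ charStabilizer G θ)] :
    ∑ ω : Z → ZMod 2, chi θ ω * chi θ (shift g⁻¹ ω) =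
      if g ∈ charStabilizer G θ then (Fintype.card (Z → ZMod 2) : ℂ) else 0 := by
  split_ifs with hg
  · rw [Finset.sum_congr rfl fun ω _ => by rw [hg ω, chi_mul_self]]
    simp
  · obtain ⟨ψ, hψ⟩ : ∃ ψ, chi θ (shift g⁻¹ ψ) ≠ chi θ ψ := by
      by_contra! h
      exact hg h
    -- Character values square to 1, so two of them with product 1 are equal.
    have key : chi θ ψ * chi θ (shift g⁻¹ ψ) ≠ 1 := fun h => hψ <| by
      calc chi θ (shift g⁻¹ ψ) = chi θ ψ * chi θ ψ * chi θ (shift g⁻¹ ψ) := by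
            rw [chi_mul_self, one_mul]
        _ = chi θ ψ := by rw [mul_assoc, h, mul_one]
    -- Translating the summation variable by `ψ` multiplies the sum by a scalar other than 1, so the
    -- sum vanishes.
    have hsum : ∑ ω : Z → ZMod 2, chi θ ω * chi θ (shift g⁻¹ ω) =
        (chi θ ψ * chi θ (shift g⁻¹ ψ)) *
          ∑ ω : Z → ZMod 2, chi θ ω * chi θ (shift g⁻¹ ω) := by
      rw [Finset.mul_sum, ← Equiv.sum_comp (Equiv.addLeft ψ)]
      refine Finset.sum_congr rfl fun ω _ => ?_
      rw [Equiv.coe_addLeft, shift_add, chi_add, chi_add]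
      ring
    by_contra h0
    exact key (mul_right_cancel₀ h0 (by rw [← hsum, one_mul]))

variable (η : Representation ℂ (charStabilizer G θ) V)

/-- The representation `χ̃_θ ⊗ η^#` of `C₂ ≀ G_θ`. -/
abbrev twistedInflation : Representation ℂ (WreathC2 Z (charStabilizer G θ)) (ℂ ⊗[ℂ] V) :=
  Representation.tprod (charExtension G θ) (inflation Z η)

theorem twistedInflation_apply (a : WreathC2 Z (charStabilizer G θ)) (v : V) :
    twistedInflation θ η a (1 ⊗ₜ v) = chi θ a.lamps • (1 ⊗ₜ η a.pos v) := by
  rw [Representation.tprod_apply, TensorProduct.map_tmul, TensorProduct.smul_tmul']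
  rfl

theorem tensor_hom_ext {B : Type*} [AddCommGroup B] [Module ℂ B] {f g : ℂ ⊗[ℂ] V →ₗ[ℂ] B}
    (h : ∀ v, f (1 ⊗ₜ v) = g (1 ⊗ₜ v)) : f = g :=
  TensorProduct.ext (LinearMap.ext_ring (LinearMap.ext h))

/-- Extension of an intertwining map from `η` to `L(X)`, by `χ_θ` in the direction of `C₂^Z`. -/
def extendByChi (f : V →ₗ[ℂ] X → ℂ) : ℂ ⊗[ℂ] V →ₗ[ℂ] (Z → ZMod 2) × X → ℂ :=
  TensorProduct.lift (LinearMap.toSpanSingleton ℂ _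
    (LinearMap.pi fun p => chi θ p.1 • (LinearMap.proj p.2 ∘ₗ f)))

theorem extendByChi_apply (f : V →ₗ[ℂ] X → ℂ) (v : V) (p : (Z → ZMod 2) × X) :
    extendByChi θ f (1 ⊗ₜ v) p = chi θ p.1 * f v p.2 := by
  simp [extendByChi]

/-- The intertwining maps from `χ̃_θ ⊗ η^#` to `L(C₂^Z × X)` are determined by the values of the
functions on `{0} × X`. -/
def twistedInflationEquiv :
    IntertwiningMap (twistedInflation θ η)
      ((permRep (WreathC2 Z G) ((Z → ZMod 2) × X)).comp
        (WreathC2.incl Z (charStabilizer G θ))) ≃ₗ[ℂ]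
    IntertwiningMap η ((permRep G X).comp (charStabilizer G θ).subtype) where
  toFun f :=
    ⟨LinearMap.funLeft ℂ ℂ (fun x => (0, x)) ∘ₗ f.toLinearMap ∘ₗ TensorProduct.mk ℂ ℂ V 1,
      fun g => by
        ext v x
        have := congrFun (f.isIntertwining _ _ ⟨0, g⟩ (1 ⊗ₜ v)) (0, x)
        rw [twistedInflation_apply, chi_zero, one_smul] at this
        refine this.trans ?_
        rw [MonoidHom.comp_apply, permRep_apply, WreathC2.smul_def]
        change f _ (shift (g : G)⁻¹ 0 + shift (g : G)⁻¹ 0, _) = f _ (0, _)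
        rw [shift_zero, add_zero]
        rfl⟩
  invFun f :=
    ⟨extendByChi θ f.toLinearMap, fun a => by
      refine tensor_hom_ext fun v => funext fun p => ?_
      have hf : f (η a.pos v) p.2 = f v ((a.pos : G)⁻¹ • p.2) :=
        congrFun (f.isIntertwining _ _ a.pos v) p.2
      rw [LinearMap.comp_apply, LinearMap.comp_apply, twistedInflation_apply, map_smul,
        MonoidHom.comp_apply, permRep_apply, WreathC2.smul_def, Pi.smul_apply,
        extendByChi_apply, extendByChi_apply, smul_eq_mul]
      have h₁ : chi θ (shift (a.pos : G)⁻¹ a.lamps + shift (a.pos : G)⁻¹ p.1) =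
          chi θ a.lamps * chi θ p.1 := by
        rw [chi_add, a.pos.2, a.pos.2]
      refine Eq.trans ?_ (congrArg₂ (· * ·) h₁.symm hf)
      exact (mul_assoc _ _ _).symm⟩
  left_inv f := by
    refine IntertwiningMap.ext (tensor_hom_ext fun v => funext fun p => ?_)
    refine (extendByChi_apply θ _ v p).trans ?_
    -- The element `(p.1, 1)` is its own inverse and moves `p` to `(0, p.2)`.
    have := congrFun (f.isIntertwining _ _ ⟨p.1, 1⟩ (1 ⊗ₜ v)) p
    rw [twistedInflation_apply, map_one, Module.End.one_apply, map_smul, Pi.smul_apply,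
      smul_eq_mul, MonoidHom.comp_apply, permRep_apply, WreathC2.smul_def] at this
    have h₁ : f (1 ⊗ₜ v) (shift (1 : G)⁻¹ p.1 + shift (1 : G)⁻¹ p.1, (1 : G)⁻¹ • p.2) =
        f (1 ⊗ₜ v) (0, p.2) := by
      rw [add_self_eq_zero_fun, inv_one, one_smul]
    have h₂ := this.trans h₁
    change chi θ p.1 * f (1 ⊗ₜ v) (0, p.2) = f (1 ⊗ₜ v) p
    rw [← h₂, ← mul_assoc, chi_mul_self, one_mul]
  right_inv f := by
    refine IntertwiningMap.ext (LinearMap.ext fun v => funext fun x => ?_)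
    refine (extendByChi_apply θ f.toLinearMap v (0, x)).trans ?_
    rw [chi_zero, one_mul]
  map_add' _ _ := rfl
  map_smul' _ _ := rfl

/-! ### Irreducibility of the induced representation -/

/-- The space of `χ̃_θ ⊗ η^#` inside that of the induced representation. -/
def inducedBase : V →ₗ[ℂ]
    IndV (WreathC2.incl Z (charStabilizer G θ)) (twistedInflation θ η) :=
  IndV.mk (WreathC2.incl Z (charStabilizer G θ)) (twistedInflation θ η) 1 ∘ₗ
    TensorProduct.mk ℂ ℂ V 1

theorem inducedBase_injective : Function.Injective (inducedBase θ η) := by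
  intro v w h
  have h₁ : (1 : ℂ) ⊗ₜ[ℂ] v = (1 : ℂ) ⊗ₜ[ℂ] w :=
    IndV.mk_one_injective (WreathC2.incl Z (charStabilizer G θ)) (twistedInflation θ η)
      (WreathC2.incl_injective _) h
  have h₂ := congrArg (TensorProduct.lid ℂ V) h₁
  rwa [TensorProduct.lid_tmul, TensorProduct.lid_tmul, one_smul, one_smul] at h₂

theorem inducedRep_incl_apply (a : WreathC2 Z (charStabilizer G θ)) (v : V) :
    inducedRep θ η (WreathC2.incl Z _ a) (inducedBase θ η v) =
      chi θ a.lamps • inducedBase θ η (η a.pos v) := by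
  refine (ind_map_apply_mk_one _ _ a (1 ⊗ₜ v)).trans ?_
  rw [twistedInflation_apply, map_smul]
  rfl

theorem inducedRep_hom_ext {B : Type*} [AddCommGroup B] [Module ℂ B]
    {f g : IndV (WreathC2.incl Z (charStabilizer G θ)) (twistedInflation θ η) →ₗ[ℂ] B}
    (h : ∀ s v, f (inducedRep θ η s (inducedBase θ η v)) =
      g (inducedRep θ η s (inducedBase θ η v))) : f = g := by
  refine ind_hom_ext _ _ fun s a => ?_
  obtain ⟨v, rfl⟩ := (TensorProduct.lid ℂ V).symm.surjective a
  exact h s v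

/-- Since `C₂^Z` is normal, `(ω, 1)` can be moved past `s` at the cost of conjugating it. -/
theorem inducedRep_lamps_apply (s : WreathC2 Z G) (ω : Z → ZMod 2) (v : V) :
    inducedRep θ η ⟨ω, 1⟩ (inducedRep θ η s (inducedBase θ η v)) =
      chi θ (shift s.pos⁻¹ ω) • inducedRep θ η s (inducedBase θ η v) := by
  have hs : (⟨ω, 1⟩ : WreathC2 Z G) * s =
      s * WreathC2.incl Z (charStabilizer G θ) ⟨shift s.pos⁻¹ ω, 1⟩ := by
    refine WreathC2.ext ?_ ?_
    · change ω + shift (1 : G) s.lamps = s.lamps + shift s.pos (shift s.pos⁻¹ ω)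
      rw [← shift_mul, mul_inv_cancel, shift_one, shift_one, add_comm]
    · change 1 * s.pos = s.pos * 1
      rw [one_mul, mul_one]
  rw [← Module.End.mul_apply, ← map_mul, hs, map_mul, Module.End.mul_apply,
    inducedRep_incl_apply, map_smul, map_one, Module.End.one_apply]

/-- The (unnormalized) projection of the induced representation to the `χ_θ`-isotypic part with
respect to `C₂^Z`. -/
def chiProjection [DecidableEq Z] : Module.End ℂ
    (IndV (WreathC2.incl Z (charStabilizer G θ)) (twistedInflation θ η)) :=
  ∑ ω : Z → ZMod 2, chi θ ω • inducedRep θ η ⟨ω, 1⟩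

theorem chiProjection_apply [DecidableEq Z] (s : WreathC2 Z G)
    [Decidable (s.pos ∈ charStabilizer G θ)] (v : V) :
    chiProjection θ η (inducedRep θ η s (inducedBase θ η v)) =
      (if s.pos ∈ charStabilizer G θ then (Fintype.card (Z → ZMod 2) : ℂ) else 0) •
        inducedRep θ η s (inducedBase θ η v) := by
  rw [← sum_chi_mul_chi_shift, Finset.sum_smul, chiProjection, LinearMap.sum_apply]
  refine Finset.sum_congr rfl fun ω _ => ?_
  rw [LinearMap.smul_apply, inducedRep_lamps_apply, smul_smul]

theorem chiProjection_mem_range [DecidableEq Z]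
    (u : IndV (WreathC2.incl Z (charStabilizer G θ)) (twistedInflation θ η)) :
    chiProjection θ η u ∈ LinearMap.range (inducedBase θ η) := by
  classical
  -- Modulo the range, containment becomes vanishing of a linear map, which can be tested on the
  -- spanning translates of the base.
  have : (LinearMap.range (inducedBase θ η)).mkQ ∘ₗ chiProjection θ η = 0 := by
    refine inducedRep_hom_ext θ η fun s v => ?_
    rw [LinearMap.comp_apply, chiProjection_apply, LinearMap.zero_apply,
      Submodule.mkQ_apply, Submodule.Quotient.mk_eq_zero]
    split_ifs with hs
    · have := inducedRep_incl_apply θ η ⟨s.lamps, ⟨s.pos, hs⟩⟩ v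
      refine Submodule.smul_mem _ _ ?_
      change inducedRep θ η s (inducedBase θ η v) = _ at this
      rw [this]
      exact Submodule.smul_mem _ _ ⟨_, rfl⟩
    · rw [zero_smul]
      exact zero_mem _
  have hu := LinearMap.congr_fun this u
  rwa [LinearMap.comp_apply, LinearMap.zero_apply, Submodule.mkQ_apply,
    Submodule.Quotient.mk_eq_zero] at hu

/-- The conjugates of the projection to the `χ_θ`-isotypic part have no common zero. -/
theorem exists_chiProjection_ne_zero [Finite G] [DecidableEq Z]
    {u : IndV (WreathC2.incl Z (charStabilizer G θ)) (twistedInflation θ η)} (hu : u ≠ 0) :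
    ∃ s, chiProjection θ η (inducedRep θ η s u) ≠ 0 := by
  classical
  have := Fintype.ofFinite (WreathC2 Z G)
  -- Summing the conjugates of the projection over the whole group gives the scalar `c`: on the
  -- translate by `t`, the substitution `s ↦ s t⁻¹` removes the dependence on `t`.
  let T : Module.End ℂ (IndV (WreathC2.incl Z (charStabilizer G θ)) (twistedInflation θ η)) :=
    ∑ s, inducedRep θ η s⁻¹ ∘ₗ chiProjection θ η ∘ₗ inducedRep θ η s
  let c : ℕ := ∑ s : WreathC2 Z G,
    if s.pos ∈ charStabilizer G θ then Fintype.card (Z → ZMod 2) else 0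
  have hc : c ≠ 0 := by
    refine (Finset.sum_pos' (fun _ _ => Nat.zero_le _) ⟨1, Finset.mem_univ _, ?_⟩).ne'
    rw [WreathC2.one_pos, if_pos (one_mem _)]
    exact Fintype.card_pos
  have hT : T = (c : ℂ) • LinearMap.id := by
    refine inducedRep_hom_ext θ η fun t v => ?_
    rw [LinearMap.sum_apply, ← Equiv.sum_comp (Equiv.mulRight t⁻¹)]
    rw [LinearMap.smul_apply, LinearMap.id_apply, Nat.cast_sum, Finset.sum_smul]
    refine Finset.sum_congr rfl fun s _ => ?_
    rw [LinearMap.comp_apply, LinearMap.comp_apply, ← Module.End.mul_apply _ (inducedRep θ η t),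
      ← map_mul, Equiv.coe_mulRight, inv_mul_cancel_right, chiProjection_apply, map_smul,
      ← Module.End.mul_apply (inducedRep θ η _), ← map_mul, mul_inv_rev, inv_inv, inv_mul_cancel_right]
    push_cast
    rfl
  by_contra! h
  have h0 : T u = 0 := by
    rw [LinearMap.sum_apply]
    exact Finset.sum_eq_zero fun s _ => by
      rw [LinearMap.comp_apply, LinearMap.comp_apply, h, map_zero]
  rw [hT, LinearMap.smul_apply, LinearMap.id_apply] at h0
  exact (smul_ne_zero (Nat.cast_ne_zero.mpr hc) hu) h0

/-- The induced representation is irreducible. -/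
theorem inducedRep_isIrreducible [Finite G] (hη : η.IsIrreducible) :
    (inducedRep θ η).IsIrreducible := by
  classical
  have hbot : ∀ W : Subrepresentation (inducedRep θ η), W ≠ ⊥ → W = ⊤ := by
    intro W hW
    -- The trace of `W` on the copy of `η`; it is all of `η` once it contains a nonzero vector.
    let S : Subrepresentation η :=
      { toSubmodule := W.toSubmodule.comap (inducedBase θ η)
        apply_mem_toSubmodule := fun g v hv => by
          have := W.apply_mem_toSubmodule (WreathC2.incl Z _ ⟨0, g⟩) hv
          rwa [inducedRep_incl_apply, chi_zero, one_smul] at this }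
    obtain ⟨w, hw, hw0⟩ := W.toSubmodule.exists_mem_ne_zero_of_ne_bot fun h =>
      hW (Subrepresentation.toSubmodule_injective h)
    obtain ⟨s, hs⟩ := exists_chiProjection_ne_zero θ η hw0
    have hmem : chiProjection θ η (inducedRep θ η s w) ∈ W.toSubmodule := by
      rw [chiProjection, LinearMap.sum_apply]
      exact sum_mem fun ω _ => Submodule.smul_mem _ _
        (W.apply_mem_toSubmodule _ (W.apply_mem_toSubmodule _ hw))
    obtain ⟨v, hv⟩ := chiProjection_mem_range θ η (inducedRep θ η s w)
    have hvS : v ∈ S.toSubmodule := by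
      rw [← hv] at hmem
      exact hmem
    have hv0 : v ≠ 0 := by
      rintro rfl
      exact hs (by rw [← hv, map_zero])
    have hS : S = ⊤ := (eq_bot_or_eq_top S).resolve_left fun h => hv0 (by rwa [h] at hvS)
    have hbase : ∀ x, inducedBase θ η x ∈ W.toSubmodule := fun x => by
      have hx : x ∈ (⊤ : Subrepresentation η).toSubmodule := Submodule.mem_top
      rw [← hS] at hx
      exact hx
    -- The translates of the base span the induced space, so the quotient by `W` is zero.
    have hQ : W.toSubmodule.mkQ = 0 := inducedRep_hom_ext θ η fun t x => by
      rw [LinearMap.zero_apply, Submodule.mkQ_apply, Submodule.Quotient.mk_eq_zero]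
      exact W.apply_mem_toSubmodule _ (hbase x)
    refine Subrepresentation.toSubmodule_injective ?_
    rw [← Submodule.ker_mkQ W.toSubmodule, hQ, LinearMap.ker_zero]
    rfl
  have hV : ∃ v : V, v ≠ 0 := by
    by_contra! h
    have : (⊥ : Subrepresentation η) = ⊤ :=
      Subrepresentation.toSubmodule_injective (Submodule.ext fun v => by simp [h v])
    exact bot_ne_top this
  obtain ⟨v, hv⟩ := hV
  have hnt : Nontrivial (Subrepresentation (inducedRep θ η)) := by
    refine ⟨⊥, ⊤, fun h => hv (inducedBase_injective θ η ?_)⟩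
    have hmem : inducedBase θ η v ∈ (⊤ : Subrepresentation (inducedRep θ η)).toSubmodule :=
      Submodule.mem_top
    rw [← h] at hmem
    rw [map_zero]
    exact hmem
  exact { eq_bot_or_eq_top := fun W => or_iff_not_imp_left.mpr (hbot W) }

end Lamplighter

end

theorem mainTheorem12 {G Z X V : Type*} [Group G] [Finite G]
    [Fintype Z] [MulAction G Z] [MulAction.IsPretransitive G Z]
    [Finite X] [MulAction G X] [MulAction.IsPretransitive G X]
    [AddCommGroup V] [Module ℂ V]
    (θ : Z → ZMod 2) (η : Representation ℂ (Lamplighter.charStabilizer G θ) V)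
    (hη : η.IsIrreducible) :
    ∃ m : ℕ,
      Lamplighter.HasMultiplicity (Lamplighter.inducedRep θ η)
        (Lamplighter.permRep (Lamplighter.WreathC2 Z G) ((Z → ZMod 2) × X)) m ∧
      Lamplighter.HasMultiplicity η
        ((Lamplighter.permRep G X).comp (Lamplighter.charStabilizer G θ).subtype) m := by
  refine ⟨_, Lamplighter.hasMultiplicity_finrank
    (Lamplighter.inducedRep_isIrreducible θ η hη) _, ?_⟩
  rw [(Representation.indIntertwiningMapEquiv _ _ _ ≪≫ₗ
    Lamplighter.twistedInflationEquiv θ η).finrank_eq]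
  exact Lamplighter.hasMultiplicity_finrank hη _
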